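/- Let $x:[0,1]\to\mathbb R$ be continuous. For $p>0$ and $n\in\mathbb N$ put $$V_n^{(p)}=\sum_{k=0}^{2^n-1}\bigl|x((k+1)2^{-n})-x(k2^{-n})\bigr|^p .$$ We say that $x$ admits the Hurst roughness exponent $H$ if there is $q\in[1,\infty)$ with $H=1/q$ such that $\lim_{n\to\infty}V_n^{(p)}=0$ for every $p>q$ and $\lim_{n\to\infty}V_n^{(p)}=\infty$ for every $0<p<q$ (so that $x$ is not constant). Let $$\theta_{m,k}=2^{m/2}\Bigl(2x\bigl(\tfrac{2k+1}{2^{m+1}}\bigr)-x\bigl(\tfrac{k}{2^m}\bigr)-x\bigl(\tfrac{k+1}{2^m}\bigr)\Bigr),\qquad m\ge 0,\ 0\le k\le 2^m-1,$$ be the Faber–Schauder coefficients of $x$, and let $$s_n=\Bigl(\sum_{m=0}^{n-1}\sum_{k=0}^{2^m-1}\theta_{m,k}^2\Bigr)^{1/2},\qquad \xi_n=\frac1n\log_2 s_n .$$ **Proposition.** Suppose that $x$ admits the Hurst roughness exponent $H$ and that the limit $\xi=\lim_{n\to\infty}\xi_n$ exists in $\mathbb R$. Then: 1. if $\xi>1/2$,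 then $H\le 1/2$; if $\xi<1/2$, then $H\ge 1/2$; 2. if $H\le 1/2$, then $H\le 1-\xi$; 3. if $H\ge 1/2$, then $H\ge 1-\xi$. -/

import Mathlib

open Filter Topology

noncomputable section

/-- The `p`-th variation of `x` sampled along the `n`-th dyadic partition of `[0,1]`. -/
def dyadicVariation (x : ℝ → ℝ) (p : ℝ) (n : ℕ) : ℝ :=
  ∑ k ∈ Finset.range (2 ^ n), |x (((k : ℝ) + 1) / 2 ^ n) - x ((k : ℝ) / 2 ^ n)| ^ p

/-- `x` admits the Hurst roughness exponent `H`: there is a `q ∈ [1, ∞)` with `H = 1 / q` such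
that the dyadic `p`-th variation tends to `0` for all `p > q` and to `∞` for all `0 < p < q`. -/
def HasHurstRoughnessExponent (x : ℝ → ℝ) (H : ℝ) : Prop :=
  ∃ q : ℝ, 1 ≤ q ∧ H = 1 / q ∧
    (∀ p : ℝ, q < p → Tendsto (dyadicVariation x p) atTop (𝓝 0)) ∧
    (∀ p : ℝ, 0 < p → p < q → Tendsto (dyadicVariation x p) atTop atTop)

/-- The Faber--Schauder coefficient `θ_{m,k}` of `x`; the factor is `2 ^ (m / 2)` with the real
exponent `m / 2`. -/
def faberSchauderCoeff (x : ℝ → ℝ) (m k : ℕ) : ℝ :=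
  (2 : ℝ) ^ ((m : ℝ) / 2) *
    (2 * x ((2 * (k : ℝ) + 1) / 2 ^ (m + 1)) - x ((k : ℝ) / 2 ^ m) - x (((k : ℝ) + 1) / 2 ^ m))

/-- `s_n`, the square root of the sum of the squared coefficients of generations `m < n`. -/
def gladyshevS (x : ℝ → ℝ) (n : ℕ) : ℝ :=
  √(∑ m ∈ Finset.range n, ∑ k ∈ Finset.range (2 ^ m), faberSchauderCoeff x m k ^ 2)

/-- `ξ_n = (1 / n) log₂ s_n`. The `s_n` are non-decreasing, and they all vanish only for affine `x`;
for all other `x`, `s_n > 0` for large `n`, so that the limit of `ξ_n` involves no logarithm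
of `0`. -/
def gladyshevXi (x : ℝ → ℝ) (n : ℕ) : ℝ :=
  1 / (n : ℝ) * Real.logb 2 (gladyshevS x n)

end

/-! Let `N_p(n)` be the `L^p` norm of the derivative of the piecewise linear interpolation of `x`
along the `n`-th dyadic partition. The `θ_{m,k}` are the Haar coefficients of that derivative, so
Parseval's identity gives `s_n² + (x 1 - x 0)² = N_2(n)²`. On the other hand
`N_p(n) = 2 ^ (n (1 - 1/p)) * (V_n^{(p)}) ^ (1/p)`, and `N_p(n)` is non-decreasing in `p`. Hence
`V_n^{(p)} → 0` with `p ≥ 2` forces `ξ ≤ 1 - 1/p`, and `V_n^{(p)} → ∞` with `p ≤ 2` forces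
`ξ ≥ 1 - 1/p`, which for `p < 1` holds because `s_n` is non-decreasing and so `ξ ≥ 0`. If `H = 1/q`,
then letting `p` decrease to `max q 2`, respectively increase to `min q 2`, places `1 - ξ` between
`H` and `1/2`, which contains all four implications.
-/

lemma sum_range_two_mul {M : Type*} [AddCommMonoid M] (f : ℕ → M) (n : ℕ) :
    ∑ k ∈ Finset.range (2 * n), f k = ∑ k ∈ Finset.range n, (f (2 * k) + f (2 * k + 1)) := by
  induction n with
  | zero => simp
  | succ n ih =>
    rw [mul_add_one, Finset.sum_range_succ, Finset.sum_range_succ, ih, Finset.sum_range_succ,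
      add_assoc]

lemma rpow_mean_le_rpow_mean {ι : Type*} (s : Finset ι) (w z : ι → ℝ) (hw : ∀ i ∈ s, 0 ≤ w i)
    (hw' : ∑ i ∈ s, w i = 1) (hz : ∀ i ∈ s, 0 ≤ z i) {r p : ℝ} (hr : 0 < r) (hrp : r ≤ p) :
    (∑ i ∈ s, w i * z i ^ r) ^ (1 / r) ≤ (∑ i ∈ s, w i * z i ^ p) ^ (1 / p) := by
  have hp : 0 < p := hr.trans_le hrp
  have mean_nonneg (t : ℝ) : 0 ≤ ∑ i ∈ s, w i * z i ^ t :=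
    Finset.sum_nonneg fun i hi => mul_nonneg (hw i hi) (Real.rpow_nonneg (hz i hi) t)
  have rpow_rpow_div : ∀ i ∈ s, w i * (z i ^ r) ^ (p / r) = w i * z i ^ p := fun i hi => by
    rw [← Real.rpow_mul (hz i hi), mul_div_cancel₀ p hr.ne']
  have jensen := Real.arith_mean_le_rpow_mean s w (fun i => z i ^ r) hw hw'
    (fun i hi => Real.rpow_nonneg (hz i hi) r) ((one_le_div hr).2 hrp)
  rw [Finset.sum_congr rfl rpow_rpow_div] at jensen
  calc (∑ i ∈ s, w i * z i ^ r) ^ (1 / r)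
      ≤ ((∑ i ∈ s, w i * z i ^ p) ^ (1 / (p / r))) ^ (1 / r) := by
        gcongr
        exact mean_nonneg r
    _ = (∑ i ∈ s, w i * z i ^ p) ^ (1 / p) := by
        rw [← Real.rpow_mul (mean_nonneg p)]
        congr 1
        field_simp

lemma tendsto_one_div_nhdsWithin {a : ℝ} (ha : a ≠ 0) (s : Set ℝ) :
    Tendsto (fun t : ℝ => 1 / t) (𝓝[s] a) (𝓝 (1 / a)) :=
  (continuousAt_const.div continuousAt_id ha).tendsto.mono_left nhdsWithin_le_nhds

/-- The `L^p` norm on `[0, 1]` of the derivative of the piecewise linear interpolation of `x` along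
the `n`-th dyadic partition, written as the `p`-th power mean of the `2 ^ n` slopes. -/
noncomputable def dyadicSlopeNorm (x : ℝ → ℝ) (p : ℝ) (n : ℕ) : ℝ :=
  (∑ k ∈ Finset.range (2 ^ n),
    ((2 : ℝ) ^ n)⁻¹ * |2 ^ n * (x ((k + 1) / 2 ^ n) - x (k / 2 ^ n))| ^ p) ^ (1 / p)

section

variable (x : ℝ → ℝ)

lemma dyadicVariation_nonneg (p : ℝ) (n : ℕ) : 0 ≤ dyadicVariation x p n :=
  Finset.sum_nonneg fun _ _ => by positivity

lemma dyadicSlopeNorm_nonneg (p : ℝ) (n : ℕ) : 0 ≤ dyadicSlopeNorm x p n := by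
  unfold dyadicSlopeNorm
  positivity

lemma dyadicSlopeNorm_le_of_exponent_le {r p : ℝ} (hr : 0 < r) (hrp : r ≤ p) (n : ℕ) :
    dyadicSlopeNorm x r n ≤ dyadicSlopeNorm x p n :=
  rpow_mean_le_rpow_mean _ _ _ (fun _ _ => by positivity) (by simp) (fun _ _ => abs_nonneg _) hr hrp

lemma dyadicSlopeNorm_eq_rpow_mul {p : ℝ} (hp : p ≠ 0) (n : ℕ) :
    dyadicSlopeNorm x p n = 2 ^ (n * (1 - 1 / p)) * dyadicVariation x p n ^ (1 / p) := by
  have sum_eq : ∑ k ∈ Finset.range (2 ^ n),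
      ((2 : ℝ) ^ n)⁻¹ * |2 ^ n * (x ((k + 1) / 2 ^ n) - x (k / 2 ^ n))| ^ p =
        2 ^ (n * (p - 1)) * dyadicVariation x p n := by
    have scale_eq : ((2 : ℝ) ^ n)⁻¹ * (2 ^ n) ^ p = 2 ^ (n * (p - 1)) := by
      rw [← Real.rpow_natCast, ← Real.rpow_neg two_pos.le, ← Real.rpow_mul two_pos.le,
        ← Real.rpow_add two_pos]
      congr 1
      ring
    rw [dyadicVariation, Finset.mul_sum]
    refine Finset.sum_congr rfl fun k _ => ?_
    rw [abs_mul, abs_of_pos (by positivity), Real.mul_rpow (by positivity) (abs_nonneg _),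
      ← mul_assoc, scale_eq]
  rw [dyadicSlopeNorm, sum_eq, Real.mul_rpow (by positivity) (dyadicVariation_nonneg x p n),
    ← Real.rpow_mul two_pos.le]
  congr 2
  field_simp

lemma dyadicSlopeNorm_two_sq (n : ℕ) :
    dyadicSlopeNorm x 2 n ^ 2 =
      2 ^ n * ∑ k ∈ Finset.range (2 ^ n), (x ((k + 1) / 2 ^ n) - x (k / 2 ^ n)) ^ 2 := by
  rw [dyadicSlopeNorm, ← Real.sqrt_eq_rpow, Real.sq_sqrt (by positivity), Finset.mul_sum]
  refine Finset.sum_congr rfl fun k _ => ?_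
  rw [Real.rpow_two, sq_abs, mul_pow, sq ((2 : ℝ) ^ n), mul_assoc,
    inv_mul_cancel_left₀ (by positivity)]

lemma sum_faberSchauderCoeff_sq (m : ℕ) :
    ∑ k ∈ Finset.range (2 ^ m), faberSchauderCoeff x m k ^ 2 =
      dyadicSlopeNorm x 2 (m + 1) ^ 2 - dyadicSlopeNorm x 2 m ^ 2 := by
  rw [dyadicSlopeNorm_two_sq, dyadicSlopeNorm_two_sq, pow_succ' 2 m, pow_succ' 2 m,
    sum_range_two_mul, Finset.mul_sum, Finset.mul_sum, ← Finset.sum_sub_distrib]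
  refine Finset.sum_congr rfl fun k _ => ?_
  have scale_sq : ((2 : ℝ) ^ ((m : ℝ) / 2)) ^ 2 = 2 ^ m := by
    rw [← Real.rpow_mul_natCast two_pos.le, Nat.cast_two, div_mul_cancel₀ _ two_ne_zero,
      Real.rpow_natCast]
  have left_endpoint : ((2 * k : ℕ) : ℝ) / (2 * 2 ^ m) = k / 2 ^ m := by
    push_cast
    exact mul_div_mul_left _ _ two_ne_zero
  have right_endpoint : (((2 * k + 1 : ℕ) : ℝ) + 1) / (2 * 2 ^ m) = (k + 1) / 2 ^ m := by
    push_cast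
    rw [add_assoc, one_add_one_eq_two, ← mul_add_one, mul_div_mul_left _ _ two_ne_zero]
  rw [faberSchauderCoeff, mul_pow, scale_sq, left_endpoint, right_endpoint, pow_succ' 2 m]
  push_cast
  ring

lemma gladyshevS_nonneg (n : ℕ) : 0 ≤ gladyshevS x n := Real.sqrt_nonneg _

lemma gladyshevS_mono : Monotone (gladyshevS x) := fun _ _ h =>
  Real.sqrt_le_sqrt <| Finset.sum_le_sum_of_subset_of_nonneg (Finset.range_mono h)
    fun _ _ _ => Finset.sum_nonneg fun _ _ => sq_nonneg _

lemma gladyshevS_sq_add_sq (n : ℕ) :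
    gladyshevS x n ^ 2 + (x 1 - x 0) ^ 2 = dyadicSlopeNorm x 2 n ^ 2 := by
  have slopeNorm_zero_sq : dyadicSlopeNorm x 2 0 ^ 2 = (x 1 - x 0) ^ 2 := by
    simp [dyadicSlopeNorm_two_sq]
  rw [gladyshevS, Real.sq_sqrt (by positivity),
    Finset.sum_congr rfl fun m _ => sum_faberSchauderCoeff_sq x m,
    Finset.sum_range_sub fun m => dyadicSlopeNorm x 2 m ^ 2, slopeNorm_zero_sq, sub_add_cancel]

end

section

variable {x : ℝ → ℝ} {n : ℕ} {c p ξ H : ℝ}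

lemma gladyshevXi_le (hc : 0 ≤ c) (h : gladyshevS x n ≤ 2 ^ (n * c)) : gladyshevXi x n ≤ c := by
  rw [gladyshevXi, one_div]
  refine inv_mul_le_of_le_mul₀ n.cast_nonneg hc ?_
  rcases (gladyshevS_nonneg x n).eq_or_lt with hS | hS
  · rw [← hS, Real.logb_zero]
    positivity
  · exact (Real.logb_le_iff_le_rpow one_lt_two hS).2 h

lemma le_gladyshevXi (hn : 0 < n) (h : 2 ^ (n * c) ≤ gladyshevS x n) : c ≤ gladyshevXi x n := by
  rw [gladyshevXi, one_div, le_inv_mul_iff₀ (Nat.cast_pos.2 hn)]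
  exact (Real.le_logb_iff_rpow_le one_lt_two (lt_of_lt_of_le (by positivity) h)).2 h

lemma eventually_gladyshevXi_le_of_tendsto_zero (hp : 2 ≤ p)
    (hV : Tendsto (dyadicVariation x p) atTop (𝓝 0)) :
    ∀ᶠ n in atTop, gladyshevXi x n ≤ 1 - 1 / p := by
  have hp0 : 0 < p := two_pos.trans_le hp
  filter_upwards [hV.eventually_le_const one_pos] with n hn
  refine gladyshevXi_le (sub_nonneg.2 ((div_le_one hp0).2 (one_le_two.trans hp))) ?_
  calc gladyshevS x n
      ≤ dyadicSlopeNorm x 2 n := by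
        refine (sq_le_sq₀ (gladyshevS_nonneg x n) (dyadicSlopeNorm_nonneg x 2 n)).1 ?_
        exact (le_add_of_nonneg_right (sq_nonneg _)).trans_eq (gladyshevS_sq_add_sq x n)
    _ ≤ dyadicSlopeNorm x p n := dyadicSlopeNorm_le_of_exponent_le x two_pos hp n
    _ = 2 ^ (n * (1 - 1 / p)) * dyadicVariation x p n ^ (1 / p) :=
        dyadicSlopeNorm_eq_rpow_mul x hp0.ne' n
    _ ≤ 2 ^ (n * (1 - 1 / p)) := mul_le_of_le_one_right (by positivity)
        (Real.rpow_le_one (dyadicVariation_nonneg x p n) hn (by positivity))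

lemma eventually_le_gladyshevXi_of_tendsto_atTop (hp1 : 1 ≤ p) (hp2 : p ≤ 2)
    (hV : Tendsto (dyadicVariation x p) atTop atTop) :
    ∀ᶠ n in atTop, 1 - 1 / p ≤ gladyshevXi x n := by
  have hp0 : 0 < p := one_pos.trans_le hp1
  have norm_tendsto : Tendsto (fun n => dyadicVariation x p n ^ (1 / p)) atTop atTop :=
    (tendsto_rpow_atTop (one_div_pos.2 hp0)).comp hV
  -- The additional `(x 1 - x 0) ^ 2` absorbs the affine part of `x`, which `s_n` does not see.
  filter_upwards [((tendsto_pow_atTop two_ne_zero).comp norm_tendsto).eventually_ge_atTop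
    (1 + (x 1 - x 0) ^ 2), eventually_gt_atTop 0] with n hn hn0
  refine le_gladyshevXi hn0 ((sq_le_sq₀ (by positivity) (gladyshevS_nonneg x n)).1 ?_)
  set a : ℝ := 2 ^ (n * (1 - 1 / p))
  have one_le_a : 1 ≤ a := Real.one_le_rpow one_le_two
    (mul_nonneg n.cast_nonneg (sub_nonneg.2 ((div_le_one hp0).2 hp1)))
  refine le_of_add_le_add_right (a := (x 1 - x 0) ^ 2) ?_
  calc a ^ 2 + (x 1 - x 0) ^ 2
      ≤ a ^ 2 + a ^ 2 * (x 1 - x 0) ^ 2 := by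
        gcongr
        exact le_mul_of_one_le_left (sq_nonneg _) (one_le_pow₀ one_le_a)
    _ = a ^ 2 * (1 + (x 1 - x 0) ^ 2) := by ring
    _ ≤ a ^ 2 * (dyadicVariation x p n ^ (1 / p)) ^ 2 := by gcongr; exact hn
    _ = dyadicSlopeNorm x p n ^ 2 := by rw [dyadicSlopeNorm_eq_rpow_mul x hp0.ne' n, mul_pow]
    _ ≤ dyadicSlopeNorm x 2 n ^ 2 := by
        have := dyadicSlopeNorm_nonneg x p n
        gcongr
        exact dyadicSlopeNorm_le_of_exponent_le x hp0 hp2 n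
    _ = gladyshevS x n ^ 2 + (x 1 - x 0) ^ 2 := (gladyshevS_sq_add_sq x n).symm

lemma nonneg_of_tendsto_gladyshevXi (hξ : Tendsto (gladyshevXi x) atTop (𝓝 ξ)) : 0 ≤ ξ := by
  by_cases h : ∃ N, gladyshevS x N ≠ 0
  · obtain ⟨N, hN⟩ := h
    have hN_pos : 0 < gladyshevS x N := (gladyshevS_nonneg x N).lt_of_ne' hN
    have hlim : Tendsto (fun n : ℕ => 1 / (n : ℝ) * Real.logb 2 (gladyshevS x N)) atTop (𝓝 0) := by
      simpa using tendsto_one_div_atTop_nhds_zero_nat.mul_const (Real.logb 2 (gladyshevS x N))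
    refine le_of_tendsto_of_tendsto hlim hξ ?_
    filter_upwards [eventually_ge_atTop N] with n hn
    exact mul_le_mul_of_nonneg_left
      (Real.logb_le_logb_of_le one_lt_two hN_pos (gladyshevS_mono x hn)) (by positivity)
  · push Not at h
    -- Here `x` is affine on the dyadic points, and `log₂ 0 = 0` gives `ξ_n = 0`.
    exact ge_of_tendsto' hξ fun n => by simp [gladyshevXi, h n]

lemma one_sub_le_one_div_of_tendsto_atTop (hξ : Tendsto (gladyshevXi x) atTop (𝓝 ξ)) (hp0 : 0 < p)
    (hp2 : p ≤ 2) (hV : Tendsto (dyadicVariation x p) atTop atTop) :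
    1 - ξ ≤ 1 / p := by
  rcases le_total 1 p with hp1 | hp1
  · exact sub_le_comm.1 (ge_of_tendsto hξ (eventually_le_gladyshevXi_of_tendsto_atTop hp1 hp2 hV))
  · linarith [nonneg_of_tendsto_gladyshevXi hξ, one_le_one_div hp0 hp1]

lemma one_div_le_one_sub_of_tendsto_zero (hξ : Tendsto (gladyshevXi x) atTop (𝓝 ξ)) (hp : 2 ≤ p)
    (hV : Tendsto (dyadicVariation x p) atTop (𝓝 0)) : 1 / p ≤ 1 - ξ :=
  le_sub_comm.1 (le_of_tendsto hξ (eventually_gladyshevXi_le_of_tendsto_zero hp hV))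

lemma HasHurstRoughnessExponent.min_le_one_sub (hH : HasHurstRoughnessExponent x H)
    (hξ : Tendsto (gladyshevXi x) atTop (𝓝 ξ)) : min H (1 / 2) ≤ 1 - ξ := by
  obtain ⟨q, -, rfl, hzero, -⟩ := hH
  have one_div_max_le : 1 / max q 2 ≤ 1 - ξ := by
    refine le_of_tendsto (tendsto_one_div_nhdsWithin (by positivity) (Set.Ioi (max q 2))) ?_
    filter_upwards [self_mem_nhdsWithin] with p (hp : max q 2 < p)
    obtain ⟨hqp, h2p⟩ := max_lt_iff.1 hp
    exact one_div_le_one_sub_of_tendsto_zero hξ h2p.le (hzero p hqp)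
  rcases max_choice q 2 with h | h <;> rw [h] at one_div_max_le
  · exact min_le_of_left_le one_div_max_le
  · exact min_le_of_right_le one_div_max_le

lemma HasHurstRoughnessExponent.one_sub_le_max (hH : HasHurstRoughnessExponent x H)
    (hξ : Tendsto (gladyshevXi x) atTop (𝓝 ξ)) : 1 - ξ ≤ max H (1 / 2) := by
  obtain ⟨q, hq1, rfl, -, htop⟩ := hH
  have hmin : 0 < min q 2 := lt_min (one_pos.trans_le hq1) two_pos
  have le_one_div_min : 1 - ξ ≤ 1 / min q 2 := by
    refine ge_of_tendsto (tendsto_one_div_nhdsWithin hmin.ne' (Set.Iio (min q 2))) ?_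
    filter_upwards [Ioo_mem_nhdsLT hmin] with p ⟨hp0, hp⟩
    obtain ⟨hpq, hp2⟩ := lt_min_iff.1 hp
    exact one_sub_le_one_div_of_tendsto_atTop hξ hp0 hp2.le (htop p hp0 hpq)
  rcases min_choice q 2 with h | h <;> rw [h] at le_one_div_min
  · exact le_max_of_le_left le_one_div_min
  · exact le_max_of_le_right le_one_div_min

end

theorem mainTheorem6_general (x : ℝ → ℝ) (H ξ : ℝ) (hH : HasHurstRoughnessExponent x H)
    (hξ : Tendsto (gladyshevXi x) atTop (𝓝 ξ)) :
    1 - ξ ∈ Set.uIcc H (1 / 2) :=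
  ⟨hH.min_le_one_sub hξ, hH.one_sub_le_max hξ⟩

theorem mainTheorem6 (x : ℝ → ℝ) (hx : ContinuousOn x (Set.Icc 0 1)) (H ξ : ℝ)
    (hH : HasHurstRoughnessExponent x H)
    (hξ : Tendsto (gladyshevXi x) atTop (𝓝 ξ)) :
    (1 / 2 < ξ → H ≤ 1 / 2) ∧
    (ξ < 1 / 2 → 1 / 2 ≤ H) ∧
    (H ≤ 1 / 2 → H ≤ 1 - ξ) ∧
    (1 / 2 ≤ H → 1 - ξ ≤ H) := by
  have h := Set.mem_uIcc.1 (mainTheorem6_general x H ξ hH hξ)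
  grind
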